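/- A (set-theoretic) tree is a partially ordered set in which the strict predecessors of each node are well-ordered; $\mathrm{sons}(x)$ denotes the set of immediate successors of a node $x$, and a branch is a $\subseteq$-maximal chain. Let $X$ be a topological space. A $\pi$-tree on $X$ is a tree $T$ together with a set $F_x\subseteq X$ (the leaf at $x$) for each node $x\in T$, such that: 1. $T$ is isomorphic to the tree of finite sequences of natural numbers ordered by extension; 2. every $F_x$ is open in $X$, and $F_{0}=X$ for the least node $0$ of $T$; 3. for every node $x$, the set $F_x$ is the union of the pairwise disjoint sets $F_s$, $s\in\mathrm{sons}(x)$; 4. for every branch $B$ of $T$, the set $\bigcap_{x\in B}F_x$ is a singleton; 5. for every point $p\in X$ and every neighbourhood $U$ of $p$ there are a node $z$ with $p\in F_z$ and a cofinite subset $C$ of $\mathrm{sons}(z)$ such that $\varnothing\neq\bigcup_{s\in C}F_s\subseteq U$. **Theorem.** Suppose that a topological space $X$ has a $\pi$-tree and $Y=X\setminus F$, where $F\subseteq X$ is $\sigma$-compact (a union of countably many compact subsets of $X$). Then the subspace $Y$ of $X$ also has a $\pi$-tree. -/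

import Mathlib

universe u v

/-- A foliage tree with leaves in `X`: a set-theoretic tree (a partially ordered set in which the
strict predecessors of every node are well-ordered) with a set `leaf x ⊆ X` at each node `x`. -/
structure FoliageTree (X : Type u) where
  Node : Type v
  [order : PartialOrder Node]
  isChain_Iio : ∀ x : Node, IsChain (· ≤ ·) (Set.Iio x)
  wellFoundedOn_Iio : ∀ x : Node, (Set.Iio x).WellFoundedOn (· < ·)
  leaf : Node → Set X

namespace FoliageTree

attribute [instance] FoliageTree.order

variable {X : Type u} (T : FoliageTree.{u, v} X)

/-- The sons (immediate successors) of a node. -/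
def sons (x : T.Node) : Set T.Node := {s | x ⋖ s}

/-- The branches, i.e. the `⊆`-maximal chains of nodes. -/
def branches : Set (Set T.Node) := {B | IsMaxChain (· ≤ ·) B}

/-- The intersection of the leaves at the nodes of `A`. -/
def fruit (A : Set T.Node) : Set X := ⋂ x ∈ A, T.leaf x

/-- The union of the leaves at the nodes of `A`. -/
def flesh (A : Set T.Node) : Set X := ⋃ x ∈ A, T.leaf x

/-- The shoot at `z`: the unions of the leaves over all cofinite sets of sons of `z`. -/
def shoot (z : T.Node) : Set (Set X) :=
  {G | ∃ C ⊆ T.sons z, (T.sons z \ C).Finite ∧ G = T.flesh C}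

/-- The nodes whose leaves contain the point `p`. -/
def scope (p : X) : Set T.Node := {y | p ∈ T.leaf y}

/-- The skeleton is isomorphic to the tree of finite sequences of natural numbers, ordered by
extension. -/
def IsOmegaAlephZeroTree : Prop :=
  ∃ e : T.Node ≃ List ℕ, ∀ x y : T.Node, x ≤ y ↔ e x <+: e y

/-- The fruit of every branch is a singleton. -/
def HasStrictBranches : Prop :=
  Nonempty T.Node ∧ ∀ B ∈ T.branches, ∃ p : X, T.fruit B = {p}

/-- The leaf at every non-maximal node is the disjoint union of the leaves at its sons. -/
def LocallyStrict : Prop :=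
  ∀ x : T.Node, ¬ IsMax x →
    T.leaf x = T.flesh (T.sons x) ∧
      ∀ s ∈ T.sons x, ∀ t ∈ T.sons x, s ≠ t → T.leaf s ∩ T.leaf t = ∅

end FoliageTree

/-- `γ` `π`-refines `δ`. -/
def PiRefines {X : Type u} (γ δ : Set (Set X)) : Prop :=
  ∀ D ∈ δ, D.Nonempty → ∃ G ∈ γ, G.Nonempty ∧ G ⊆ D

namespace FoliageTree

variable {X : Type u} [TopologicalSpace X] (T : FoliageTree.{u, v} X)

/-- All leaves are open subsets of the space. -/
def IsOpenIn : Prop := ∀ z : T.Node, IsOpen (T.leaf z)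

/-- `T` is a Baire foliage tree on the space `X`. -/
structure IsBaireFoliageTree : Prop where
  isOpenIn : T.IsOpenIn
  locallyStrict : T.LocallyStrict
  isOmegaAlephZeroTree : T.IsOmegaAlephZeroTree
  hasStrictBranches : T.HasStrictBranches
  leaf_root : ∃ r : T.Node, (∀ x, r ≤ x) ∧ T.leaf r = Set.univ

/-- `T` grows into the space `X`: for every neighbourhood `U` of a point `p` there is a node `z`
with `p` in its leaf such that the shoot at `z` `π`-refines `{U}`. -/
def GrowsInto : Prop :=
  ∀ p : X, ∀ U ∈ nhds p, ∃ z ∈ T.scope p, PiRefines (T.shoot z) {U}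

/-- `T` is a `π`-tree on the space `X`. -/
def IsPiTree : Prop := T.IsBaireFoliageTree ∧ T.GrowsInto

end FoliageTree

/-- The space `X` has a `π`-tree. (The skeleton of a `π`-tree is countable, so nothing is lost by
taking its nodes in the lowest universe.) -/
def HasPiTree (X : Type u) [TopologicalSpace X] : Prop :=
  ∃ T : FoliageTree.{u, 0} X, T.IsPiTree

/-! Following the sons around each point turns a `π`-tree on `X` into a continuous bijection `φ`
onto the Baire space, with the cylinders pulling back to the leaves. Thus `F` becomes a union of
increasing compact sets `K j`, and the sequences outside all of them have to be partitioned anew.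

A sequence outside `K j` leaves the tree of `K j` at a finite stage. `ExitRank` cuts a cylinder
minus `K j` into countably many shells, by that stage plus a number coded in the exit digit. The
sons of a cone `s` are its shells for `K s.length`. A son of a shell fixes one more digit and is a
shell of smaller rank or, on exit, a cone missing `K j`.

Compactness leaves only finitely many digits inside the tree of `K j`, so every shell has infinitely
many sons (`infinite_admissible`). Finite ranks drive each branch through ever longer cones, so its
point avoids every `K j` (`exists_fruit`). Every initial segment of a remaining point is the word of
a shell around it, and the sons of that shell use distinct digits; hence the old cofinite sets of
sons yield new ones (`exists_absorbing_node`). -/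

namespace BaireScheme

open Set Topology Filter

/-! ### Finite sequences and cylinders -/

/-- The list of the first `n` values of `f`. -/
def initSeg (f : ℕ → ℕ) (n : ℕ) : List ℕ := (List.range n).map f

/-- The sequences that extend the finite sequence `s`. -/
def cyl (s : List ℕ) : Set (ℕ → ℕ) := {f | initSeg f s.length = s}

@[simp] lemma length_initSeg (f : ℕ → ℕ) (n : ℕ) : (initSeg f n).length = n := by
  simp [initSeg]

@[simp] lemma initSeg_zero (f : ℕ → ℕ) : initSeg f 0 = [] := rfl

lemma initSeg_succ (f : ℕ → ℕ) (n : ℕ) : initSeg f (n + 1) = initSeg f n ++ [f n] := by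
  simp [initSeg, List.range_succ]

lemma mem_cyl {f : ℕ → ℕ} {s : List ℕ} : f ∈ cyl s ↔ initSeg f s.length = s := Iff.rfl

lemma mem_cyl_initSeg (f : ℕ → ℕ) (n : ℕ) : f ∈ cyl (initSeg f n) := by
  simp [mem_cyl]

lemma mem_cyl_append {f : ℕ → ℕ} {s : List ℕ} {k : ℕ} :
    f ∈ cyl (s ++ [k]) ↔ f ∈ cyl s ∧ f s.length = k := by
  simp only [mem_cyl, List.length_append, List.length_singleton, initSeg_succ]
  constructor
  · intro h
    have := List.append_inj h (by simp)
    simpa using this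
  · rintro ⟨h, h'⟩
    rw [h, h']

lemma mem_cyl_iff_getElem {f : ℕ → ℕ} {s : List ℕ} :
    f ∈ cyl s ↔ ∀ i, ∀ h : i < s.length, s[i] = f i := by
  rw [mem_cyl]
  constructor
  · intro h i hi
    have : s[i] = (initSeg f s.length)[i]'(by simpa using hi) := by simp [h]
    rw [this]; simp [initSeg]
  · intro h
    apply List.ext_getElem (by simp)
    intro i h1 h2
    rw [h i h2]; simp [initSeg]

lemma cyl_anti_of_prefix {s t : List ℕ} (h : s <+: t) : cyl t ⊆ cyl s := by
  intro f hf
  rw [mem_cyl_iff_getElem] at hf ⊢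
  intro i hi
  rw [← hf i (hi.trans_le h.length_le), h.getElem hi]

lemma initSeg_prefix (f : ℕ → ℕ) {m n : ℕ} (h : m ≤ n) : initSeg f m <+: initSeg f n := by
  induction n, h using Nat.le_induction with
  | base => exact List.prefix_rfl
  | succ n _ ih => exact ih.trans (by rw [initSeg_succ]; exact List.prefix_append _ _)

lemma isOpen_cyl (s : List ℕ) : IsOpen (cyl s) := by
  induction s using List.reverseRecOn with
  | nil => simp [cyl]
  | append_singleton s k ih =>
    have : cyl (s ++ [k]) = cyl s ∩ (fun f : ℕ → ℕ => f s.length) ⁻¹' {k} := by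
      ext f; simp [mem_cyl_append]
    rw [this]
    exact ih.inter ((isOpen_discrete _).preimage (continuous_apply _))

/-- A chain of finite sequences has a common infinite extension. -/
lemma exists_mem_cyl_of_chain {B : Set (List ℕ)}
    (hB : ∀ s ∈ B, ∀ t ∈ B, s <+: t ∨ t <+: s) : ∃ f, ∀ s ∈ B, f ∈ cyl s := by
  classical
  have key : ∀ i, ∃ k, ∀ s ∈ B, ∀ h : i < s.length, s[i] = k := by
    intro i
    by_cases h : ∃ t ∈ B, i < t.length
    · obtain ⟨t, ht, hi⟩ := h
      refine ⟨t[i], fun s hs his => ?_⟩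
      rcases hB s hs t ht with h | h
      · exact h.getElem his
      · exact (h.getElem hi).symm
    -- No member of `B` reaches position `i`, so any value serves.
    · push Not at h
      exact ⟨0, fun s hs his => absurd his (not_lt.2 (h s hs))⟩
  choose f hf using key
  exact ⟨f, fun s hs => mem_cyl_iff_getElem.2 fun i hi => hf i s hs hi⟩

/-! ### Leaving the tree of a compact set -/

/-- The cylinder over `s` meets `K`. -/
def Meets (K : Set (ℕ → ℕ)) (s : List ℕ) : Prop := (cyl s ∩ K).Nonempty

lemma Meets.of_prefix {K : Set (ℕ → ℕ)} {s t : List ℕ} (h : Meets K t) (hst : s <+: t) :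
    Meets K s :=
  h.mono (inter_subset_inter_left _ (cyl_anti_of_prefix hst))

/-- A coordinate maps `K` onto a compact, hence finite, subset of the discrete space `ℕ`. -/
lemma finite_setOf_meets_append {K : Set (ℕ → ℕ)} (hK : IsCompact K) (s : List ℕ) :
    {k | Meets K (s ++ [k])}.Finite := by
  refine ((hK.image (continuous_apply s.length)).finite_of_discrete).subset ?_
  rintro k ⟨f, hf, hfK⟩
  exact ⟨f, hfK, (mem_cyl_append.1 hf).2⟩

/-- Otherwise points of `K` agreeing with `f` on longer and longer initial segments would converge
to `f`. -/
lemma exists_not_meets {K : Set (ℕ → ℕ)} (hK : IsClosed K) {f : ℕ → ℕ} (hf : f ∉ K) :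
    ∃ m, ¬ Meets K (initSeg f m) := by
  by_contra! h
  choose g hg hgK using h
  refine hf (hK.mem_of_tendsto (b := atTop) (f := g) ?_ (Eventually.of_forall hgK))
  rw [tendsto_pi_nhds]
  intro i
  refine tendsto_const_nhds.congr' ?_
  filter_upwards [eventually_gt_atTop i] with m hm
  have h1 := mem_cyl_iff_getElem.1 (hg m) i (by simpa using hm)
  rw [← h1]; simp [initSeg]

/-- `f` leaves the tree of `K` at some place `m ≥ n`, and `d` is the sum of `m - n` and the first
component of the pair coded by `f m`. -/
def ExitRank (K : Set (ℕ → ℕ)) : ℕ → ℕ → (ℕ → ℕ) → Prop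
  | 0, n, f => ¬ Meets K (initSeg f (n + 1)) ∧ (Nat.unpair (f n)).1 = 0
  | d + 1, n, f => (Meets K (initSeg f (n + 1)) ∧ ExitRank K d (n + 1) f) ∨
      (¬ Meets K (initSeg f (n + 1)) ∧ (Nat.unpair (f n)).1 = d + 1)

lemma exitRank_of_not_meets {K : Set (ℕ → ℕ)} {d n : ℕ} {f : ℕ → ℕ}
    (h : ¬ Meets K (initSeg f (n + 1))) : ExitRank K d n f ↔ (Nat.unpair (f n)).1 = d := by
  cases d <;> simp [ExitRank, h]

lemma exitRank_of_meets {K : Set (ℕ → ℕ)} {d n : ℕ} {f : ℕ → ℕ}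
    (h : Meets K (initSeg f (n + 1))) :
    ExitRank K d n f ↔ d ≠ 0 ∧ ExitRank K (d - 1) (n + 1) f := by
  cases d <;> simp [ExitRank, h]

lemma ExitRank.unique {K : Set (ℕ → ℕ)} {d d' n : ℕ} {f : ℕ → ℕ}
    (h : ExitRank K d n f) (h' : ExitRank K d' n f) : d = d' := by
  induction d generalizing d' n with
  | zero =>
    rw [exitRank_of_not_meets h.1] at h'
    exact h.2.symm.trans h'
  | succ d ih =>
    by_cases hm : Meets K (initSeg f (n + 1))
    · rw [exitRank_of_meets hm] at h h'
      have := ih h.2 h'.2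
      omega
    · rw [exitRank_of_not_meets hm] at h h'
      exact h.symm.trans h'

lemma exists_exitRank {K : Set (ℕ → ℕ)} (hK : IsClosed K) {f : ℕ → ℕ} (hf : f ∉ K) (n : ℕ) :
    ∃ d, ExitRank K d n f := by
  have key : ∀ m n, ¬ Meets K (initSeg f (n + m)) → ∃ d, ExitRank K d n f := by
    intro m
    induction m with
    | zero =>
      intro n h
      exact ⟨_, (exitRank_of_not_meets fun h' =>
        h (h'.of_prefix (initSeg_prefix f (Nat.le_succ n)))).2 rfl⟩
    | succ m ih =>
      intro n h
      by_cases hm : Meets K (initSeg f (n + 1))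
      · obtain ⟨d, hd⟩ := ih (n + 1) (by rwa [add_assoc, add_comm 1])
        exact ⟨d + 1, (exitRank_of_meets hm).2 ⟨by simp, by simpa using hd⟩⟩
      · exact ⟨_, (exitRank_of_not_meets hm).2 rfl⟩
  obtain ⟨m, hm⟩ := exists_not_meets hK hf
  exact key m n fun h => hm (h.of_prefix (initSeg_prefix f (Nat.le_add_left m n)))

/-! ### The pruned scheme of cones and shells -/

/-- The labels of the nodes of the pruned scheme: `cone s` stands for the cylinder over `s`, and
`shell j d s` for the part of it that leaves the tree of the `j`-th compact set with rank `d`. -/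
inductive Label
  | cone (s : List ℕ)
  | shell (j d : ℕ) (s : List ℕ)

/-- The finite sequence of a label. -/
def Label.word : Label → List ℕ
  | .cone s => s
  | .shell _ _ s => s

/-- The numbers `k` such that `s ++ [k]` occurs below the shell of rank `d` at `s`. -/
def admissible (K : Set (ℕ → ℕ)) (d : ℕ) (s : List ℕ) : Set ℕ :=
  {k | (Meets K (s ++ [k]) ∧ d ≠ 0) ∨ (¬ Meets K (s ++ [k]) ∧ (Nat.unpair k).1 = d)}

/-- Infinitely many digits code a pair with first component `d`, and only finitely many of them stay
in the tree of `K`. -/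
lemma infinite_admissible {K : Set (ℕ → ℕ)} (hK : IsCompact K) (d : ℕ) (s : List ℕ) :
    (admissible K d s).Infinite := by
  have h1 : {k : ℕ | (Nat.unpair k).1 = d}.Infinite := by
    refine Set.infinite_of_injective_forall_mem (f := fun i => Nat.pair d i) ?_ ?_
    · intro i j h
      exact (Nat.pair_eq_pair.1 h).2
    · intro i; simp
  refine (h1.sdiff (finite_setOf_meets_append hK s)).mono ?_
  rintro k ⟨hk, hk'⟩
  exact Or.inr ⟨hk', hk⟩

section Prune

variable (K : ℕ → Set (ℕ → ℕ))

/-- The set of sequences that a label stands for. -/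
def Label.leaf : Label → Set (ℕ → ℕ)
  | .cone s => cyl s
  | .shell j d s => cyl s ∩ {f | ExitRank (K j) d s.length f}

/-- The `i`-th admissible number. -/
noncomputable def nthAdmissible (j d : ℕ) (s : List ℕ) (i : ℕ) : ℕ :=
  Nat.nth (· ∈ admissible (K j) d s) i

open Classical in
/-- The label of the `i`-th son. -/
noncomputable def Label.child : Label → ℕ → Label
  | .cone s, i => .shell s.length i s
  | .shell j d s, i =>
    if Meets (K j) (s ++ [nthAdmissible K j d s i]) then
      .shell j (d - 1) (s ++ [nthAdmissible K j d s i])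
    else .cone (s ++ [nthAdmissible K j d s i])

variable {K}

lemma leaf_subset_cyl_word (σ : Label) : σ.leaf K ⊆ cyl σ.word := by
  cases σ with
  | cone s => exact Subset.rfl
  | shell j d s => exact inter_subset_left

lemma word_child_shell (j d : ℕ) (s : List ℕ) (i : ℕ) :
    ((Label.shell j d s).child K i).word = s ++ [nthAdmissible K j d s i] := by
  simp only [Label.child]
  split_ifs <;> rfl

lemma word_prefix_word_child (σ : Label) (i : ℕ) : σ.word <+: (σ.child K i).word := by
  cases σ with
  | cone s => exact List.prefix_rfl
  | shell j d s => rw [word_child_shell]; exact List.prefix_append _ _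

lemma nthAdmissible_mem (hK : ∀ j, IsCompact (K j)) (j d : ℕ) (s : List ℕ) (i : ℕ) :
    nthAdmissible K j d s i ∈ admissible (K j) d s :=
  Nat.nth_mem_of_infinite (infinite_admissible (hK j) d s) i

lemma nthAdmissible_injective (hK : ∀ j, IsCompact (K j)) (j d : ℕ) (s : List ℕ) :
    Function.Injective (nthAdmissible K j d s) :=
  Nat.nth_injective (infinite_admissible (hK j) d s)

lemma mem_leaf_child_shell (hK : ∀ j, IsCompact (K j)) {j d : ℕ} {s : List ℕ} {i : ℕ}
    {f : ℕ → ℕ} : f ∈ ((Label.shell j d s).child K i).leaf K ↔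
      f ∈ (Label.shell j d s).leaf K ∧ f s.length = nthAdmissible K j d s i := by
  have hadm := nthAdmissible_mem hK j d s i
  simp only [Label.child]
  generalize nthAdmissible K j d s i = k at hadm ⊢
  have hseg : f ∈ cyl s → f s.length = k → initSeg f (s.length + 1) = s ++ [k] := by
    intro h1 h2
    rw [initSeg_succ, mem_cyl.1 h1, h2]
  split_ifs with hm
  · simp only [Label.leaf, mem_inter_iff, mem_cyl_append, mem_ofPred_eq, List.length_append,
      List.length_singleton]
    have hd : d ≠ 0 := by
      rcases hadm with h | h
      · exact h.2
      · exact absurd hm h.1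
    constructor
    · rintro ⟨⟨h1, h2⟩, h3⟩
      exact ⟨⟨h1, (exitRank_of_meets (by rwa [hseg h1 h2])).2 ⟨hd, h3⟩⟩, h2⟩
    · rintro ⟨⟨h1, h3⟩, h2⟩
      exact ⟨⟨h1, h2⟩, ((exitRank_of_meets (by rwa [hseg h1 h2])).1 h3).2⟩
  · simp only [Label.leaf, mem_inter_iff, mem_cyl_append, mem_ofPred_eq]
    have hd : (Nat.unpair k).1 = d := by
      rcases hadm with h | h
      · exact absurd h.1 hm
      · exact h.2
    constructor
    · rintro ⟨h1, h2⟩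
      exact ⟨⟨h1, (exitRank_of_not_meets (by rwa [hseg h1 h2])).2 (by rw [h2, hd])⟩, h2⟩
    · rintro ⟨⟨h1, -⟩, h2⟩
      exact ⟨h1, h2⟩

lemma exists_eq_nthAdmissible {j d : ℕ} {s : List ℕ} {f : ℕ → ℕ}
    (hK : ∀ j, IsCompact (K j)) (hf : f ∈ (Label.shell j d s).leaf K) :
    ∃ i, f s.length = nthAdmissible K j d s i := by
  have hmem : f s.length ∈ admissible (K j) d s := by
    have hseg : initSeg f (s.length + 1) = s ++ [f s.length] := by
      rw [initSeg_succ, mem_cyl.1 hf.1]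
    by_cases hm : Meets (K j) (s ++ [f s.length])
    · exact Or.inl ⟨hm, ((exitRank_of_meets (by rwa [hseg])).1 hf.2).1⟩
    · exact Or.inr ⟨hm, (exitRank_of_not_meets (by rwa [hseg])).1 hf.2⟩
  have hrange : range (nthAdmissible K j d s) = admissible (K j) d s :=
    Nat.range_nth_of_infinite (infinite_admissible (hK j) d s)
  rw [← hrange] at hmem
  obtain ⟨i, hi⟩ := hmem
  exact ⟨i, hi.symm⟩

lemma leaf_child_subset (hK : ∀ j, IsCompact (K j)) (σ : Label) (i : ℕ) :
    (σ.child K i).leaf K ⊆ σ.leaf K := by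
  intro f hf
  cases σ with
  | cone s => exact hf.1
  | shell j d s => exact ((mem_leaf_child_shell hK).1 hf).1

lemma exists_mem_leaf_child (hK : ∀ j, IsCompact (K j)) {σ : Label} {f : ℕ → ℕ}
    (hf : f ∈ σ.leaf K) (hfK : ∀ j, f ∉ K j) : ∃ i, f ∈ (σ.child K i).leaf K := by
  cases σ with
  | cone s =>
    obtain ⟨d, hd⟩ := exists_exitRank (hK s.length).isClosed (hfK s.length) s.length
    exact ⟨d, hf, hd⟩
  | shell j d s =>
    obtain ⟨i, hi⟩ := exists_eq_nthAdmissible hK hf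
    exact ⟨i, (mem_leaf_child_shell hK).2 ⟨hf, hi⟩⟩

lemma eq_of_mem_leaf_child (hK : ∀ j, IsCompact (K j)) {σ : Label} {f : ℕ → ℕ} {i i' : ℕ}
    (h : f ∈ (σ.child K i).leaf K) (h' : f ∈ (σ.child K i').leaf K) : i = i' := by
  cases σ with
  | cone s => exact ExitRank.unique h.2 h'.2
  | shell j d s =>
    exact nthAdmissible_injective hK j d s
      (((mem_leaf_child_shell hK).1 h).2.symm.trans ((mem_leaf_child_shell hK).1 h').2)

/-- A shell is the union of its sons, which are cylinders or shells of smaller rank; at rank `0` all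
of them are cylinders. -/
lemma isOpen_leaf (hK : ∀ j, IsCompact (K j)) (σ : Label) : IsOpen (σ.leaf K) := by
  cases σ with
  | cone s => exact isOpen_cyl s
  | shell j d s =>
    have hU : ∀ d s, (Label.shell j d s).leaf K =
        ⋃ i, ((Label.shell j d s).child K i).leaf K := by
      intro d s
      ext f
      simp only [mem_iUnion, mem_leaf_child_shell hK]
      exact ⟨fun h => (exists_eq_nthAdmissible hK h).imp fun i hi => ⟨h, hi⟩, fun ⟨i, h⟩ => h.1⟩
    induction d generalizing s with
    | zero =>
      rw [hU]
      refine isOpen_iUnion fun i => ?_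
      have : ¬ Meets (K j) (s ++ [nthAdmissible K j 0 s i]) := by
        rcases nthAdmissible_mem hK j 0 s i with h | h
        · exact absurd rfl h.2
        · exact h.1
      simp only [Label.child, if_neg this]
      exact isOpen_cyl _
    | succ d ih =>
      rw [hU]
      refine isOpen_iUnion fun i => ?_
      simp only [Label.child]
      split_ifs
      · exact ih _
      · exact isOpen_cyl _

variable (K) in
/-- The label of the node `t` of the pruned scheme. -/
noncomputable def label (t : List ℕ) : Label := t.foldl (Label.child K) (.cone [])

lemma label_append (t : List ℕ) (i : ℕ) : label K (t ++ [i]) = (label K t).child K i := by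
  simp [label]

lemma label_initSeg_succ (a : ℕ → ℕ) (n : ℕ) :
    label K (initSeg a (n + 1)) = (label K (initSeg a n)).child K (a n) := by
  rw [initSeg_succ, label_append]

/-- Each step inside the tree of `K j` lowers the rank, and at rank `0` only exit digits are
admissible. -/
lemma exists_cone_of_shell (hK : ∀ j, IsCompact (K j)) (a : ℕ → ℕ) {n j d : ℕ} {s : List ℕ}
    (h : label K (initSeg a n) = .shell j d s) :
    ∃ m > n, ∃ s', label K (initSeg a m) = .cone s' ∧ s.length < s'.length ∧
      ¬ Meets (K j) s' := by
  induction d generalizing n s with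
  | zero =>
    have : ¬ Meets (K j) (s ++ [nthAdmissible K j 0 s (a n)]) := by
      rcases nthAdmissible_mem hK j 0 s (a n) with h | h
      · exact absurd rfl h.2
      · exact h.1
    refine ⟨n + 1, Nat.lt_succ_self n, _, ?_, ?_, this⟩
    · rw [label_initSeg_succ, h, Label.child, if_neg this]
    · simp
  | succ d ih =>
    by_cases hm : Meets (K j) (s ++ [nthAdmissible K j (d + 1) s (a n)])
    · obtain ⟨m, hm, s', h1, h2, h3⟩ := ih (n := n + 1) (by
        rw [label_initSeg_succ, h, Label.child, if_pos hm, Nat.add_sub_cancel])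
      refine ⟨m, by omega, s', h1, ?_, h3⟩
      simp only [List.length_append, List.length_singleton] at h2
      omega
    · refine ⟨n + 1, Nat.lt_succ_self n, _, ?_, ?_, hm⟩
      · rw [label_initSeg_succ, h, Label.child, if_neg hm]
      · simp

lemma exists_cone_of_cone (hK : ∀ j, IsCompact (K j)) (a : ℕ → ℕ) {n : ℕ} {s : List ℕ}
    (h : label K (initSeg a n) = .cone s) :
    ∃ m > n, ∃ s', label K (initSeg a m) = .cone s' ∧ s.length < s'.length ∧
      ¬ Meets (K s.length) s' := by
  obtain ⟨m, hm, h'⟩ := exists_cone_of_shell hK a (n := n + 1) (j := s.length) (d := a n) (s := s)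
    (by rw [label_initSeg_succ, h, Label.child])
  exact ⟨m, by omega, h'⟩

lemma exists_long_cone (hK : ∀ j, IsCompact (K j)) (a : ℕ → ℕ) (N : ℕ) :
    ∃ m ≥ N, ∃ s, label K (initSeg a m) = .cone s ∧ N ≤ s.length := by
  induction N with
  | zero => exact ⟨0, le_rfl, [], rfl, le_rfl⟩
  | succ N ih =>
    obtain ⟨m, hm, s, h, hs⟩ := ih
    obtain ⟨m', hm', s', h', hs', -⟩ := exists_cone_of_cone hK a h
    exact ⟨m', by omega, s', h', by omega⟩

lemma leaf_label_initSeg_anti (hK : ∀ j, IsCompact (K j)) (a : ℕ → ℕ) :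
    Antitone fun n => (label K (initSeg a n)).leaf K :=
  antitone_nat_of_succ_le fun n => by
    rw [label_initSeg_succ]; exact leaf_child_subset hK _ _

lemma word_label_initSeg_prefix (a : ℕ → ℕ) {m n : ℕ} (h : m ≤ n) :
    (label K (initSeg a m)).word <+: (label K (initSeg a n)).word := by
  induction n, h using Nat.le_induction with
  | base => exact List.prefix_rfl
  | succ n _ ih => exact ih.trans (by rw [label_initSeg_succ]; exact word_prefix_word_child _ _)

/-- Every branch of the pruned scheme has exactly one point, and it lies outside the compact
sets. -/
lemma exists_fruit (hK : ∀ j, IsCompact (K j)) (hmono : Monotone K) (a : ℕ → ℕ) :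
    ∃ f, (∀ j, f ∉ K j) ∧ ∀ g, (∀ n, g ∈ (label K (initSeg a n)).leaf K) ↔ g = f := by
  obtain ⟨f, hf⟩ := exists_mem_cyl_of_chain
    (B := range fun n => (label K (initSeg a n)).word) (by
      rintro _ ⟨m, rfl⟩ _ ⟨n, rfl⟩
      exact (le_total m n).imp (word_label_initSeg_prefix a) (word_label_initSeg_prefix a))
  replace hf : ∀ n, f ∈ cyl (label K (initSeg a n)).word := fun n => hf _ ⟨n, rfl⟩
  refine ⟨f, fun j hj => ?_, fun g => ⟨fun hg => ?_, ?_⟩⟩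
  -- Below a cone of length at least `j` lies a cone missing `K s.length`, which contains `K j` by
  -- monotonicity.
  · obtain ⟨m, -, s, h, hs⟩ := exists_long_cone hK a j
    obtain ⟨m', -, s', h', -, hs'⟩ := exists_cone_of_cone hK a h
    refine hs' ⟨f, ?_, hmono hs hj⟩
    have := hf m'
    rwa [h'] at this
  · funext i
    obtain ⟨m, -, s, h, hs⟩ := exists_long_cone hK a (i + 1)
    have h1 := hf m
    have h2 := leaf_subset_cyl_word _ (hg m)
    rw [h, mem_cyl_iff_getElem] at h1 h2
    rw [← h1 i hs, ← h2 i hs]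
  · rintro rfl n
    -- The leaf at a later cone is the whole cylinder over its word, so it contains the limit
    -- sequence.
    obtain ⟨m, hm, s, h, -⟩ := exists_long_cone hK a n
    refine leaf_label_initSeg_anti hK a hm ?_
    have := hf m
    simp only [h] at this ⊢
    exact this

/-- A son of a shell lengthens the word by exactly one digit, and a son of a cone keeps it, so no
initial segment of `p` is skipped. -/
lemma exists_shell_initSeg (hK : ∀ j, IsCompact (K j)) {p : ℕ → ℕ} (hp : ∀ j, p ∉ K j) (n : ℕ) :
    ∃ t j d, label K t = .shell j d (initSeg p n) ∧ p ∈ (label K t).leaf K := by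
  have cone_step : ∀ t n, label K t = .cone (initSeg p n) →
      ∃ t j d, label K t = .shell j d (initSeg p n) ∧ p ∈ (label K t).leaf K := by
    intro t n ht
    obtain ⟨i, hi⟩ := exists_mem_leaf_child hK (σ := label K t)
      (by rw [ht]; exact mem_cyl_initSeg p n) hp
    rw [← label_append] at hi
    exact ⟨t ++ [i], n, i, by rw [label_append, ht, Label.child, length_initSeg], hi⟩
  induction n with
  | zero => exact cone_step [] 0 rfl
  | succ n ih =>
    obtain ⟨t, j, d, ht, hpt⟩ := ih
    obtain ⟨i, hi⟩ := exists_mem_leaf_child hK hpt hp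
    have hpn : nthAdmissible K j d (initSeg p n) i = p n := by
      rw [ht, mem_leaf_child_shell hK, length_initSeg] at hi
      exact hi.2.symm
    rw [← label_append] at hi
    by_cases hm : Meets (K j) (initSeg p n ++ [nthAdmissible K j d (initSeg p n) i])
    · refine ⟨t ++ [i], j, d - 1, ?_, hi⟩
      rw [label_append, ht, Label.child, if_pos hm, hpn, ← initSeg_succ]
    · refine cone_step (t ++ [i]) (n + 1) ?_
      rw [label_append, ht, Label.child, if_neg hm, hpn, ← initSeg_succ]

/-- Every initial segment `s` of a point `p` outside the compact sets has a node `t` around `p`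
whose sons lie in the cylinders over distinct sons of `s`. -/
lemma exists_absorbing_node (hK : ∀ j, IsCompact (K j)) {p : ℕ → ℕ} (hp : ∀ j, p ∉ K j) (n : ℕ) :
    ∃ t, p ∈ (label K t).leaf K ∧ ∃ g : ℕ → ℕ, Function.Injective g ∧
      ∀ i, (label K (t ++ [i])).leaf K ⊆ cyl (initSeg p n ++ [g i]) := by
  obtain ⟨t, j, d, ht, hpt⟩ := exists_shell_initSeg hK hp n
  refine ⟨t, hpt, _, nthAdmissible_injective hK j d (initSeg p n), fun i => ?_⟩
  rw [label_append, ht]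
  exact (leaf_subset_cyl_word _).trans_eq (by rw [word_child_shell])

end Prune

/-! ### Sons and branches in the tree of finite sequences -/

section Order

variable {N : Type*} [PartialOrder N] {e : N ≃ List ℕ} (he : ∀ x y : N, x ≤ y ↔ e x <+: e y)

include he

lemma covBy_iff_exists_append {x y : N} : x ⋖ y ↔ ∃ k, e y = e x ++ [k] := by
  have hlt : ∀ {a b : N}, a < b → (e a).length < (e b).length := by
    intro a b hab
    have h := (he a b).1 hab.le
    refine lt_of_le_of_ne h.length_le fun hl => hab.ne (e.injective (h.eq_of_length hl))
  constructor
  · rintro ⟨hxy, hc⟩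
    obtain ⟨t, ht⟩ := (he x y).1 hxy.le
    cases t with
    | nil => exact absurd (e.injective (by simpa using ht)) hxy.ne
    | cons k t =>
      refine ⟨k, ?_⟩
      have h1 : x < e.symm (e x ++ [k]) := by
        refine lt_of_le_of_ne ((he _ _).2 (by simp)) fun h => ?_
        have := congrArg (fun z => (e z).length) h
        simp at this
      have h2 : e.symm (e x ++ [k]) ≤ y := (he _ _).2 (by simp [← ht])
      rcases h2.lt_or_eq with h | h
      · exact absurd h (hc h1)
      · rw [← h]; simp
  · rintro ⟨k, hk⟩
    have hlen : (e y).length = (e x).length + 1 := by simp [hk]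
    refine ⟨lt_of_le_of_ne ((he _ _).2 (by simp [hk])) fun h => ?_, fun c h1 h2 => ?_⟩
    · rw [h] at hlen; omega
    · have := hlt h1; have := hlt h2; omega

lemma isMaxChain_setOf_mem_cyl (a : ℕ → ℕ) : IsMaxChain (· ≤ ·) {x : N | a ∈ cyl (e x)} := by
  refine ⟨fun x hx y hy _ => ?_, fun B hB hsub => hsub.antisymm fun y hy => ?_⟩
  · change x ≤ y ∨ y ≤ x
    rw [he, he]
    rw [mem_ofPred_eq, mem_cyl] at hx hy
    rw [← hx, ← hy]
    exact (le_total _ _).imp (initSeg_prefix a) (initSeg_prefix a)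
  -- A node along `a` longer than `y` is comparable with `y`, so it must extend `y`.
  · have hz : e.symm (initSeg a ((e y).length + 1)) ∈ B := hsub (by simp [mem_cyl_initSeg])
    have := hB.total hy hz
    rw [he, he, e.apply_symm_apply] at this
    rcases this with h | h
    · exact cyl_anti_of_prefix h (mem_cyl_initSeg a _)
    · have := h.length_le
      simp at this

lemma isMaxChain_iff_exists_cyl {B : Set N} :
    IsMaxChain (· ≤ ·) B ↔ ∃ a, B = {x : N | a ∈ cyl (e x)} := by
  refine ⟨fun hB => ?_, ?_⟩
  · obtain ⟨a, ha⟩ := exists_mem_cyl_of_chain (B := e '' B) (by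
      rintro _ ⟨x, hx, rfl⟩ _ ⟨y, hy, rfl⟩
      rw [← he, ← he]
      exact hB.1.total hx hy)
    exact ⟨a, hB.2 (isMaxChain_setOf_mem_cyl he a).1 fun x hx => ha _ ⟨x, hx, rfl⟩⟩
  · rintro ⟨a, rfl⟩
    exact isMaxChain_setOf_mem_cyl he a

end Order

/-! ### Translation between `π`-trees and schemes of leaves -/

/-- A `π`-tree given by the leaves at the finite sequences. -/
structure IsPiScheme {X : Type*} [TopologicalSpace X] (V : List ℕ → Set X) : Prop where
  isOpen : ∀ s, IsOpen (V s)
  root : V [] = univ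
  eq_iUnion : ∀ s, V s = ⋃ k, V (s ++ [k])
  disjoint : ∀ s k l, k ≠ l → Disjoint (V (s ++ [k])) (V (s ++ [l]))
  fruit : ∀ a, ∃ p, ⋂ n, V (initSeg a n) = {p}
  grows : ∀ p, ∀ U ∈ 𝓝 p, ∃ s, p ∈ V s ∧ ∀ᶠ k in cofinite, V (s ++ [k]) ⊆ U

lemma iInter_initSeg {X : Type*} (V : List ℕ → Set X) (a : ℕ → ℕ) :
    ⋂ n, V (initSeg a n) = ⋂ s ∈ {s | a ∈ cyl s}, V s := by
  ext p
  simp only [mem_iInter, mem_ofPred_eq]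
  exact ⟨fun h s hs => by rw [← mem_cyl.1 hs]; exact h _, fun h n => h _ (mem_cyl_initSeg a n)⟩

lemma exists_isPiScheme {X : Type*} [TopologicalSpace X] (hX : HasPiTree X) :
    ∃ V : List ℕ → Set X, IsPiScheme V := by
  obtain ⟨T, ⟨hopen, hloc, ⟨e, he⟩, ⟨-, hbr⟩, r, hr, hrX⟩, hgrow⟩ := hX
  have hsons : ∀ x y : T.Node, y ∈ T.sons x ↔ ∃ k, e y = e x ++ [k] := fun x y =>
    covBy_iff_exists_append he
  have hson : ∀ s k, e.symm (s ++ [k]) ∈ T.sons (e.symm s) := fun s k =>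
    (hsons _ _).2 ⟨k, by simp⟩
  have hmax : ∀ x : T.Node, ¬ IsMax x := by
    intro x hx
    have := (hson (e x) 0).1
    rw [e.symm_apply_apply] at this
    exact hx.not_lt this
  refine ⟨fun s => T.leaf (e.symm s), fun s => hopen _, ?_, fun s => ?_, fun s k l hkl => ?_,
    fun a => ?_, fun p U hU => ?_⟩
  · have : e.symm [] = r := le_antisymm ((he _ _).2 (by simp)) (hr _)
    simp only [this, hrX]
  · rw [(hloc _ (hmax _)).1]
    ext p
    simp only [FoliageTree.flesh, mem_iUnion, hsons, e.apply_symm_apply]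
    constructor
    · rintro ⟨y, ⟨k, hk⟩, hp⟩
      exact ⟨k, by rwa [← hk, e.symm_apply_apply]⟩
    · rintro ⟨k, hp⟩
      exact ⟨_, ⟨k, by simp⟩, hp⟩
  · rw [disjoint_iff_inter_eq_empty]
    exact (hloc _ (hmax (e.symm s))).2 _ (hson s k) _ (hson s l) (by simpa using hkl)
  · obtain ⟨p, hp⟩ := hbr _ (isMaxChain_setOf_mem_cyl he a)
    refine ⟨p, ?_⟩
    rw [← hp, iInter_initSeg (fun s => T.leaf (e.symm s))]
    ext q
    simp only [FoliageTree.fruit, mem_iInter, mem_ofPred_eq]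
    exact ⟨fun h x hx => by simpa using h (e x) hx, fun h s hs => h _ (by simpa using hs)⟩
  · obtain ⟨z, hz, href⟩ := hgrow p U hU
    obtain ⟨G, ⟨C, -, hfin, rfl⟩, -, hGU⟩ := href U rfl ⟨p, mem_of_mem_nhds hU⟩
    refine ⟨e z, by rw [e.symm_apply_apply]; exact hz, ?_⟩
    have hinj : Function.Injective fun k => e.symm (e z ++ [k]) := by
      intro k l h; simpa using h
    refine (hfin.preimage hinj.injOn).subset ?_
    intro k hk
    refine ⟨by simpa using hson (e z) k, fun hC => hk ?_⟩
    exact (subset_biUnion_of_mem (u := T.leaf) hC).trans hGU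

/-- The finite sequences of natural numbers, ordered by extension. -/
def FinSeq : Type := List ℕ

/-- A finite sequence as a list. -/
def FinSeq.toList : FinSeq ≃ List ℕ := Equiv.refl _

instance : PartialOrder FinSeq where
  le s t := s.toList <+: t.toList
  lt s t := s.toList <+: t.toList ∧ ¬ t.toList <+: s.toList
  lt_iff_le_not_ge _ _ := Iff.rfl
  le_refl _ := List.prefix_rfl
  le_trans _ _ _ := List.IsPrefix.trans
  le_antisymm _ _ h h' := FinSeq.toList.injective (h.eq_of_length_le h'.length_le)

lemma FinSeq.le_iff (s t : FinSeq) : s ≤ t ↔ s.toList <+: t.toList := Iff.rfl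

/-- The foliage tree of a family of leaves at the finite sequences. -/
def foliageTree {X : Type*} (V : List ℕ → Set X) : FoliageTree.{_, 0} X where
  Node := FinSeq
  isChain_Iio := fun _ s hs t ht _ =>
    List.prefix_or_prefix_of_prefix ((FinSeq.le_iff _ _).1 (le_of_lt hs))
      ((FinSeq.le_iff _ _).1 (le_of_lt ht))
  wellFoundedOn_Iio := fun x => by
    refine WellFounded.wellFoundedOn (Subrelation.wf
      (r := InvImage (· < ·) fun s : FinSeq => s.toList.length) ?_ (InvImage.wf _ wellFounded_lt))
    intro s t hst
    have h := (FinSeq.le_iff s t).1 hst.le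
    exact lt_of_le_of_ne h.length_le fun hl =>
      hst.ne (FinSeq.toList.injective (h.eq_of_length hl))
  leaf s := V s.toList

lemma IsPiScheme.nonempty {X : Type*} [TopologicalSpace X] {V : List ℕ → Set X}
    (hV : IsPiScheme V) (s : List ℕ) : (V s).Nonempty := by
  obtain ⟨f, hf⟩ := exists_mem_cyl_of_chain (B := {s}) (by simp)
  obtain ⟨p, hp⟩ := hV.fruit f
  have : p ∈ ⋂ n, V (initSeg f n) := by rw [hp]; rfl
  refine ⟨p, ?_⟩
  have := mem_iInter.1 this s.length
  rwa [mem_cyl.1 (hf s rfl)] at this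

lemma IsPiScheme.hasPiTree {X : Type*} [TopologicalSpace X] {V : List ℕ → Set X}
    (hV : IsPiScheme V) : HasPiTree X := by
  have hsons : ∀ x y : List ℕ, y ∈ (foliageTree V).sons x ↔ ∃ k, y = x ++ [k] := fun x y =>
    covBy_iff_exists_append FinSeq.le_iff
  refine ⟨foliageTree V, ⟨hV.isOpen, fun x _ => ⟨?_, ?_⟩, ⟨FinSeq.toList, FinSeq.le_iff⟩,
    ⟨⟨([] : List ℕ)⟩, fun B hB => ?_⟩, ([] : List ℕ), fun x => List.nil_prefix, hV.root⟩, ?_⟩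
  · refine (hV.eq_iUnion x).trans ?_
    ext p
    simp only [FoliageTree.flesh, mem_iUnion]
    constructor
    · rintro ⟨k, hp⟩
      exact ⟨List.append x [k], (hsons _ _).2 ⟨k, rfl⟩, hp⟩
    · rintro ⟨y, hy, hp⟩
      obtain ⟨k, rfl⟩ := (hsons _ _).1 hy
      exact ⟨k, hp⟩
  · intro s hs t ht hst
    obtain ⟨k, rfl⟩ := (hsons _ _).1 hs
    obtain ⟨l, rfl⟩ := (hsons _ _).1 ht
    exact disjoint_iff_inter_eq_empty.1 (hV.disjoint x k l fun h => hst (by rw [h]))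
  · obtain ⟨a, rfl⟩ := (isMaxChain_iff_exists_cyl FinSeq.le_iff).1 hB
    obtain ⟨p, hp⟩ := hV.fruit a
    rw [iInter_initSeg] at hp
    exact ⟨p, hp⟩
  · intro p U hU
    obtain ⟨s, hs, hfin⟩ := hV.grows p U hU
    refine ⟨s, hs, ?_⟩
    rintro D hD -
    obtain rfl : D = U := hD
    let C : Set (List ℕ) := {y | ∃ k, y = s ++ [k] ∧ V (s ++ [k]) ⊆ D}
    refine ⟨(foliageTree V).flesh C, ⟨C, ?_, ?_, rfl⟩, ?_, ?_⟩
    · rintro y ⟨k, hk, -⟩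
      exact (hsons _ _).2 ⟨k, hk⟩
    · refine (Set.Finite.image (fun k => s ++ [k]) hfin).subset ?_
      rintro y ⟨hy, hyC⟩
      obtain ⟨k, rfl⟩ := (hsons _ _).1 hy
      exact ⟨k, fun h => hyC ⟨k, rfl, h⟩, rfl⟩
    · obtain ⟨k, hk⟩ := hfin.exists
      obtain ⟨q, hq⟩ := hV.nonempty (s ++ [k])
      exact ⟨q, mem_biUnion (show s ++ [k] ∈ C from ⟨k, rfl, hk⟩) hq⟩
    · refine iUnion₂_subset ?_
      rintro _ ⟨k, rfl, hk⟩
      exact hk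

/-! ### Coordinates in the Baire space -/

lemma IsPiScheme.exists_coordinates {X : Type*} [TopologicalSpace X] {V : List ℕ → Set X}
    (hV : IsPiScheme V) : ∃ φ : X → ℕ → ℕ, ∀ s, V s = φ ⁻¹' cyl s := by
  have hnext : ∀ s p, ∃ k, p ∈ V s → p ∈ V (s ++ [k]) := by
    intro s p
    by_cases hp : p ∈ V s
    · have hp' := hp
      rw [hV.eq_iUnion, mem_iUnion] at hp'
      exact hp'.imp fun _ h _ => h
    · exact ⟨0, fun h => absurd h hp⟩
  choose next hnext using hnext
  let q : X → ℕ → List ℕ := fun p n => Nat.rec [] (fun _ s => s ++ [next s p]) n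
  let φ : X → ℕ → ℕ := fun p n => next (q p n) p
  have hq : ∀ p n, initSeg (φ p) n = q p n := by
    intro p n
    induction n with
    | zero => rfl
    | succ n ih => rw [initSeg_succ, ih]
  have hqV : ∀ p n, p ∈ V (initSeg (φ p) n) := by
    intro p n
    rw [hq]
    induction n with
    | zero => simp [q, hV.root]
    | succ n ih => exact hnext _ _ ih
  refine ⟨φ, fun s => ?_⟩
  ext p
  rw [mem_preimage]
  constructor
  · induction s using List.reverseRecOn with
    | nil => intro _; rfl
    | append_singleton s k ih =>
      intro hp
      have hps : p ∈ V s := by rw [hV.eq_iUnion]; exact mem_iUnion.2 ⟨k, hp⟩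
      have hs := mem_cyl.1 (ih hps)
      refine mem_cyl_append.2 ⟨ih hps, ?_⟩
      by_contra hne
      have h1 : p ∈ V (s ++ [φ p s.length]) := by
        have := hqV p (s.length + 1)
        rwa [initSeg_succ, hs] at this
      exact disjoint_left.1 (hV.disjoint s _ _ hne) h1 hp
  · intro h
    have := hqV p s.length
    rwa [mem_cyl.1 h] at this

/-- The fibre of `φ` over `a` is the fruit of the branch along `a`, a singleton. -/
lemma IsPiScheme.bijective {X : Type*} [TopologicalSpace X] {V : List ℕ → Set X}
    (hV : IsPiScheme V) {φ : X → ℕ → ℕ} (hφ : ∀ s, V s = φ ⁻¹' cyl s) :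
    Function.Bijective φ := by
  have hmem : ∀ a p, p ∈ ⋂ n, V (initSeg a n) ↔ φ p = a := by
    intro a p
    simp only [hφ, mem_iInter, mem_preimage]
    constructor
    · intro h
      funext i
      rw [← mem_cyl_iff_getElem.1 (h (i + 1)) i (by simp)]
      simp [initSeg]
    · rintro rfl n
      exact mem_cyl_initSeg _ n
  refine ⟨fun p p' h => ?_, fun a => ?_⟩
  · obtain ⟨q, hq⟩ := hV.fruit (φ p')
    have h1 := (hmem (φ p') p).2 h
    have h2 := (hmem (φ p') p').2 rfl
    rw [hq] at h1 h2
    exact h1.trans h2.symm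
  · obtain ⟨q, hq⟩ := hV.fruit a
    exact ⟨q, (hmem a q).1 (by rw [hq]; rfl)⟩

lemma IsPiScheme.continuous {X : Type*} [TopologicalSpace X] {V : List ℕ → Set X}
    (hV : IsPiScheme V) {φ : X → ℕ → ℕ} (hφ : ∀ s, V s = φ ⁻¹' cyl s) : Continuous φ := by
  refine continuous_pi fun n => continuous_def.2 fun S _ => ?_
  have : (fun p => φ p n) ⁻¹' S = ⋃ s ∈ {s : List ℕ | ∃ h : n < s.length, s[n] ∈ S}, V s := by
    ext p
    simp only [hφ, mem_preimage, mem_iUnion, mem_ofPred_eq]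
    constructor
    · intro hp
      exact ⟨initSeg (φ p) (n + 1), ⟨by simp, by simpa [initSeg] using hp⟩, mem_cyl_initSeg _ _⟩
    · rintro ⟨s, ⟨hn, hs⟩, hp⟩
      rwa [← mem_cyl_iff_getElem.1 hp n hn]
  rw [this]
  exact isOpen_biUnion fun s _ => hV.isOpen s

/-! ### Removal of a `σ`-compact set -/

/-- Removing the preimages of an increasing sequence of compact sets of sequences. -/
lemma IsPiScheme.compl {X : Type*} [TopologicalSpace X] {V : List ℕ → Set X}
    (hV : IsPiScheme V) {φ : X → ℕ → ℕ} (hφ : ∀ s, V s = φ ⁻¹' cyl s)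
    {K : ℕ → Set (ℕ → ℕ)} (hK : ∀ j, IsCompact (K j)) (hmono : Monotone K) {Y : Set X}
    (hY : ∀ x, x ∈ Y ↔ ∀ j, φ x ∉ K j) :
    IsPiScheme fun t => {y : Y | φ y ∈ (label K t).leaf K} where
  isOpen t := (isOpen_leaf hK _).preimage ((hV.continuous hφ).comp continuous_subtype_val)
  root := by
    ext y
    simp [label, Label.leaf, cyl]
  eq_iUnion t := by
    ext y
    simp only [mem_ofPred_eq, mem_iUnion, label_append]
    exact ⟨fun h => exists_mem_leaf_child hK h ((hY _).1 y.2),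
      fun ⟨i, h⟩ => leaf_child_subset hK _ _ h⟩
  disjoint t k l hkl := by
    refine disjoint_left.2 fun y h h' => hkl ?_
    simp only [mem_ofPred_eq, label_append] at h h'
    exact eq_of_mem_leaf_child hK h h'
  fruit a := by
    obtain ⟨f, hf, hfruit⟩ := exists_fruit hK hmono a
    obtain ⟨x, rfl⟩ := (hV.bijective hφ).2 f
    refine ⟨⟨x, (hY x).2 hf⟩, ?_⟩
    ext y
    simp only [mem_iInter, mem_ofPred_eq, mem_singleton_iff, hfruit]
    rw [(hV.bijective hφ).1.eq_iff, Subtype.ext_iff]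
  grows p U hU := by
    obtain ⟨U', hU', hsub⟩ := mem_nhds_subtype Y p U |>.1 hU
    obtain ⟨s, hs, hcof⟩ := hV.grows p U' hU'
    rw [hφ, mem_preimage] at hs
    obtain ⟨t, ht, g, hg, hsons⟩ := exists_absorbing_node hK ((hY _).1 p.2) s.length
    refine ⟨t, ht, ?_⟩
    -- Injectivity of `g` makes preimages of cofinite sets cofinite.
    filter_upwards [hg.tendsto_cofinite.eventually hcof] with i hi y hy
    refine hsub (hi ?_)
    rw [hφ, mem_preimage]
    have := hsons i hy
    rwa [mem_cyl.1 hs] at this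

end BaireScheme

theorem mainTheorem1 {X : Type u} [TopologicalSpace X] (hX : HasPiTree X)
    (F : Set X) (hF : IsSigmaCompact F) (Y : Set X) (hY : Y = Set.univ \ F) :
    HasPiTree Y := by
  obtain ⟨V, hV⟩ := BaireScheme.exists_isPiScheme hX
  obtain ⟨φ, hφ⟩ := hV.exists_coordinates
  obtain ⟨C, hC, rfl⟩ := hF
  -- Finite unions of the compact pieces make the sequence increasing, as `exists_fruit` requires.
  refine (hV.compl hφ (K := fun j => φ '' Set.accumulate C j)
    (fun j => (isCompact_accumulate hC j).image (hV.continuous hφ))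
    (fun i j hij => Set.image_mono (Set.monotone_accumulate hij)) (Y := Y) ?_).hasPiTree
  intro x
  subst hY
  simp only [Set.mem_sdiff, Set.mem_univ, true_and, Set.mem_iUnion, not_exists,
    (hV.bijective hφ).1.mem_set_image, Set.mem_accumulate]
  exact ⟨fun h j i hi => h i hi.2, fun h i hi => h i i ⟨le_rfl, hi⟩⟩
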